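/- Let $\omega_1,\omega_2\in\mathbb{C}$ be $\mathbb{R}$-linearly independent and such that $\tau=\omega_2/\omega_1$ satisfies $\operatorname{Im}(\tau)>0$, $|\tau|\ge 1$ and $-\tfrac12\le\operatorname{Re}(\tau)\le\tfrac12$. Let $\Omega=\mathbb{Z}\omega_1+\mathbb{Z}\omega_2$ and let $$\sigma_\Omega(z)=z\prod_{\omega\in\Omega\setminus\{0\}}\left(1-\frac{z}{\omega}\right)\exp\left(\frac{z}{\omega}+\frac{z^2}{2\omega^2}\right)$$ be the Weierstrass $\sigma$-function of $\Omega$. For an algebraic number $x$ let $H(x)$ denote its absolute multiplicative height. Assume that $\operatorname{Im}(\tau)\le 1.9$ and that $\omega_1$ and $\omega_2$ are algebraic over $\mathbb{Q}$. Then there is a real number $A>0$, depending only on $\omega_1$ and $\omega_2$, such that the following holds for all real numbers $d\ge 1$ and $H\ge e$. If $z\in\mathbb{C}\setminus\Omega$ is such that both $z$ and $\sigma_\Omega(z)$ are algebraic, $\max\{H(z),H(\sigma_\Omega(z))\}\le H$ and $[\mathbb{Q}(z,\sigma_\Omega(z)):\mathbb{Q}]\le d$, then $$|z|\le A\,d\sqrt{\log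 H}.$$ -/

import Mathlib

/-- The Weierstrass `σ`-function of the lattice spanned by a pair of periods,
`σ(z) = z ∏_{ω ≠ 0} (1 - z/ω) exp(z/ω + z²/(2ω²))`, the product being taken over the nonzero
lattice points. -/
noncomputable def PeriodPair.weierstrassSigma (L : PeriodPair) (z : ℂ) : ℂ :=
  z * ∏' ω : {ω : ℂ // ω ∈ L.lattice ∧ ω ≠ 0},
    (1 - z / (ω : ℂ)) * Complex.exp (z / (ω : ℂ) + z ^ 2 / (2 * (ω : ℂ) ^ 2))

/-! Off the lattice σ grows like a Gaussian, whereas algebraicity with bounded height and degree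
makes |σ(z)| at most H^d. Multiplying the product row by row, with w = z/ω₁, gives |σ(z)| = const ·
θ(w) · exp Q(w). Here θ is doubly periodic (`normalizedTheta`) and Q(w) = Re(w²(π²/6 + S)) + π (Im
w)²/Im τ, where S is `rowSum` (`pi_mul_mul_hasProd_eq`). Since S is small, Q is positive definite as
long as Im τ stays below 6/π ≈ 1.9099; this explains the bound 1.9 (`exists_pos_mul_sq_le_re`). Near
its zeros θ is bounded below by the distance to a lattice point ω, so |σ(z)| ≥ c exp(κ|z|²)|z - ω|
(`exists_le_norm_weierstrassSigma`). As the periods are algebraic, Liouville bounds |z - ω| from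
below (`exists_log_norm_sub_lattice_bound`). Taking logarithms, κ|z|² ≤ O(d² log H) + O(d|z|), and
the claim follows. -/

/-! ### Absolute convergence of the σ-product. -/

lemma norm_one_sub_mul_exp_sub_one_le {x : ℂ} (hx : ‖x‖ ≤ 1) :
    ‖(1 - x) * Complex.exp (x + x ^ 2 / 2) - 1‖ ≤ Real.exp 2 * ‖x‖ ^ 3 := by
  -- The derivative vanishes to order two at 0, so the mean value inequality yields a cubic bound.
  have hderiv (y : ℂ) : HasDerivAt (fun y : ℂ ↦ (1 - y) * Complex.exp (y + y ^ 2 / 2))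
      (-y ^ 2 * Complex.exp (y + y ^ 2 / 2)) y := by
    have h1 : HasDerivAt (fun y : ℂ ↦ 1 - y) (-1) y := by
      simpa using (hasDerivAt_id y).const_sub 1
    have h2 : HasDerivAt (fun y : ℂ ↦ y + y ^ 2 / 2) (1 + y) y := by
      exact ((hasDerivAt_id' y).add ((hasDerivAt_pow 2 y).div_const 2)).congr_deriv (by simp)
    exact (h1.mul h2.cexp).congr_deriv (by ring)
  have hbound : ∀ y ∈ Metric.closedBall (0 : ℂ) ‖x‖,
      ‖-y ^ 2 * Complex.exp (y + y ^ 2 / 2)‖ ≤ ‖x‖ ^ 2 * Real.exp 2 := by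
    intro y hy
    rw [mem_closedBall_zero_iff] at hy
    have hy1 := hy.trans hx
    rw [norm_mul, norm_neg, norm_pow]
    gcongr
    refine (Complex.norm_exp_le_exp_norm _).trans (Real.exp_le_exp.mpr ?_)
    refine (norm_add_le _ _).trans ?_
    rw [norm_div, norm_pow, Complex.norm_two]
    nlinarith [norm_nonneg y]
  have := Convex.norm_image_sub_le_of_norm_hasDerivWithin_le
    (fun y _ ↦ (hderiv y).hasDerivWithinAt) hbound (convex_closedBall _ _)
    (x := 0) (y := x) (by simp) (by simp)
  norm_num at this
  linarith

namespace PeriodPair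

variable (L : PeriodPair)

lemma summable_factor_sub_one (z : ℂ) : Summable fun l : L.lattice ↦
    (1 - z / l) * Complex.exp (z / l + (z / l) ^ 2 / 2) - 1 := by
  have hs : Summable fun l : L.lattice ↦ ‖l‖⁻¹ ^ 3 :=
    ZLattice.summable_norm_pow_inv L.lattice 3 (by simp)
  refine Summable.of_norm_bounded_eventually (hs.mul_left (Real.exp 2 * ‖z‖ ^ 3)) ?_
  have hfin : {l : L.lattice | ‖l‖ < ‖z‖}.Finite :=
    (isCompact_iff_finite.mp (isCompact_closedBall (0 : L.lattice) ‖z‖)).subset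
      fun l hl ↦ by simpa using (show ‖l‖ < ‖z‖ from hl).le
  filter_upwards [hfin.compl_mem_cofinite] with l hl
  have hl' : ‖z‖ ≤ ‖l‖ := not_lt.mp hl
  have hle : ‖z / (l : ℂ)‖ ≤ 1 := by
    rw [norm_div]
    exact div_le_one_of_le₀ hl' (norm_nonneg _)
  refine (norm_one_sub_mul_exp_sub_one_le hle).trans (le_of_eq ?_)
  rw [norm_div, div_eq_mul_inv, mul_pow, mul_assoc]
  rfl

/-- With the convention z / 0 = 0 the factor at the origin is 1, so the origin may be included. -/
lemma weierstrassSigma_eq_mul_tprod (z : ℂ) : L.weierstrassSigma z = z * ∏' l : L.lattice,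
    ((1 - z / l) * Complex.exp (z / l + (z / l) ^ 2 / 2)) := by
  have key (F : ℂ → ℂ) (hF : F 0 = 1) :
      ∏' ω : {ω : ℂ // ω ∈ L.lattice ∧ ω ≠ 0}, F ω = ∏' l : L.lattice, F l := by
    have h1 := tprod_subtype {ω : ℂ | ω ∈ L.lattice ∧ ω ≠ 0} F
    have h2 := tprod_subtype (L.lattice : Set ℂ) F
    refine h1.trans (Eq.trans ?_ h2.symm)
    congr 1
    ext ω
    by_cases h0 : ω = 0
    · subst h0
      simp [hF]
    · by_cases hω : ω ∈ L.lattice <;> simp [Set.mulIndicator, h0, hω]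
  rw [weierstrassSigma, key (fun ω ↦ (1 - z / ω) * Complex.exp (z / ω + z ^ 2 / (2 * ω ^ 2)))
    (by simp)]
  congr 2
  ext l
  congr 3
  rw [div_pow, div_div, mul_comm]

/-- The product over the lattice, indexed by the coordinates with respect to the two periods. -/
lemma exists_hasProd_weierstrassSigma (z : ℂ) : ∃ a : ℂ, L.weierstrassSigma z = z * a ∧
    (Summable fun p : ℤ × ℤ ↦ (1 - (z / L.ω₁) / (p.2 + p.1 * (L.ω₂ / L.ω₁))) *
      Complex.exp ((z / L.ω₁) / (p.2 + p.1 * (L.ω₂ / L.ω₁)) +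
        ((z / L.ω₁) / (p.2 + p.1 * (L.ω₂ / L.ω₁))) ^ 2 / 2) - 1) ∧
    HasProd (fun p : ℤ × ℤ ↦ (1 - (z / L.ω₁) / (p.2 + p.1 * (L.ω₂ / L.ω₁))) *
      Complex.exp ((z / L.ω₁) / (p.2 + p.1 * (L.ω₂ / L.ω₁)) +
        ((z / L.ω₁) / (p.2 + p.1 * (L.ω₂ / L.ω₁))) ^ 2 / 2)) a := by
  have hω₁ : L.ω₁ ≠ 0 := by simpa using L.indep.ne_zero 0
  -- The swap puts the coefficient of ω₂ first, so that fibres over the first coordinate are rows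
  -- parallel to ω₁.
  let e : ℤ × ℤ ≃ L.lattice := (Equiv.prodComm ℤ ℤ).trans L.latticeEquivProd.symm.toEquiv
  have he (p : ℤ × ℤ) : z / (e p : ℂ) = (z / L.ω₁) / (p.2 + p.1 * (L.ω₂ / L.ω₁)) := by
    have : ((e p : L.lattice) : ℂ) = p.2 * L.ω₁ + p.1 * L.ω₂ := L.latticeEquiv_symm_apply _
    rw [this, div_div]
    congr 1
    field_simp
  have hs := L.summable_factor_sub_one z
  have hm := Complex.multipliable_one_add_of_summable hs
  simp only [add_sub_cancel] at hm
  refine ⟨_, L.weierstrassSigma_eq_mul_tprod z, ?_, ?_⟩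
  · have := (e.summable_iff).mpr hs
    simpa only [Function.comp_def, he] using this
  · have := (e.hasProd_iff).mpr hm.hasProd
    simpa only [Function.comp_def, he] using this

end PeriodPair

/-! ### Rows of the lattice product and Euler's sine product. -/

section SineProduct

open Filter Topology Complex Finset

lemma Finset.prod_Icc_neg_succ {M : Type*} [CommMonoid M] (f : ℤ → M) (N : ℕ) :
    ∏ m ∈ Icc (-((N + 1 : ℕ) : ℤ)) ((N + 1 : ℕ) : ℤ), f m =
      f (N + 1) * f (-(N + 1)) * ∏ m ∈ Icc (-(N : ℤ)) N, f m := by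
  have h : Icc (-((N + 1 : ℕ) : ℤ)) ((N + 1 : ℕ) : ℤ) =
      insert ((N : ℤ) + 1) (insert (-((N : ℤ) + 1)) (Icc (-(N : ℤ)) N)) := by
    ext m
    simp only [mem_Icc, mem_insert]
    omega
  rw [h, prod_insert, prod_insert, mul_assoc]
  · simp only [mem_Icc]
    omega
  · simp only [mem_insert, mem_Icc]
    omega

lemma intCast_add_ne_zero_of_sin_ne_zero {w : ℂ} (hw : sin (Real.pi * w) ≠ 0) (m : ℤ) :
    (m : ℂ) + w ≠ 0 := by
  intro h
  apply hw
  rw [Complex.sin_eq_zero_iff]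
  exact ⟨-m, by rw [eq_neg_of_add_eq_zero_right h]; push_cast; ring⟩

/-- Writing each factor as (m + w - z)(m + w + z)/(m + w)² and pairing m with -m produces partial
Euler products at w - z, w + z and w. -/
lemma prod_Icc_one_sub_sq_div_sq {w : ℂ} (hw : sin (Real.pi * w) ≠ 0) (z : ℂ) (N : ℕ) :
    ∏ m ∈ Icc (-(N : ℤ)) N, (1 - z ^ 2 / ((m : ℂ) + w) ^ 2) =
      (Real.pi * (w - z) * ∏ j ∈ range N, (1 - (w - z) ^ 2 / ((j : ℂ) + 1) ^ 2)) *
      (Real.pi * (w + z) * ∏ j ∈ range N, (1 - (w + z) ^ 2 / ((j : ℂ) + 1) ^ 2)) /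
      (Real.pi * w * ∏ j ∈ range N, (1 - w ^ 2 / ((j : ℂ) + 1) ^ 2)) ^ 2 := by
  have hπ : (Real.pi : ℂ) ≠ 0 := by exact_mod_cast Real.pi_ne_zero
  have hw0 : w ≠ 0 := by simpa using intCast_add_ne_zero_of_sin_ne_zero hw 0
  have hfac (j : ℕ) : (1 - w ^ 2 / ((j : ℂ) + 1) ^ 2) ≠ 0 := by
    have h1 := intCast_add_ne_zero_of_sin_ne_zero hw (j + 1)
    have h2 := intCast_add_ne_zero_of_sin_ne_zero hw (-(j + 1))
    have h3 : (j : ℂ) + 1 ≠ 0 := by exact_mod_cast Nat.succ_ne_zero j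
    push_cast at h1 h2
    rw [one_sub_div (pow_ne_zero _ h3)]
    refine div_ne_zero ?_ (pow_ne_zero _ h3)
    have : ((j : ℂ) + 1) ^ 2 - w ^ 2 = -((((j : ℂ) + 1) + w) * (-((j : ℂ) + 1) + w)) := by ring
    rw [this]
    exact neg_ne_zero.mpr (mul_ne_zero h1 h2)
  induction N with
  | zero =>
    simp
    field_simp
    ring
  | succ N ih =>
    rw [Finset.prod_Icc_neg_succ, ih, prod_range_succ, prod_range_succ, prod_range_succ]
    have h1 := intCast_add_ne_zero_of_sin_ne_zero hw (N + 1)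
    have h2 := intCast_add_ne_zero_of_sin_ne_zero hw (-(N + 1))
    have h3 : (N : ℂ) + 1 ≠ 0 := by exact_mod_cast Nat.succ_ne_zero N
    have h4 : ∏ j ∈ range N, (1 - w ^ 2 / ((j : ℂ) + 1) ^ 2) ≠ 0 := prod_ne_zero_iff.mpr
      fun j _ ↦ hfac j
    have h5 := hfac N
    have hstep : (1 - z ^ 2 / (((N + 1 : ℤ) : ℂ) + w) ^ 2) *
        (1 - z ^ 2 / (((-(N + 1) : ℤ) : ℂ) + w) ^ 2) =
        (1 - (w - z) ^ 2 / ((N : ℂ) + 1) ^ 2) * (1 - (w + z) ^ 2 / ((N : ℂ) + 1) ^ 2) /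
        (1 - w ^ 2 / ((N : ℂ) + 1) ^ 2) ^ 2 := by
      push_cast at h1 h2 ⊢
      have h6 : ((N : ℂ) + 1) ^ 2 - w ^ 2 ≠ 0 := by
        have : ((N : ℂ) + 1) ^ 2 - w ^ 2 = -((((N : ℂ) + 1) + w) * (-((N : ℂ) + 1) + w)) := by
          ring
        rw [this]
        exact neg_ne_zero.mpr (mul_ne_zero h1 h2)
      generalize (N : ℂ) + 1 = n at *
      field_simp
      ring
    rw [hstep]
    simp only [mul_pow, div_eq_mul_inv, mul_inv]
    ring

lemma tendsto_prod_Icc_one_sub_sq_div_sq {w : ℂ} (hw : sin (Real.pi * w) ≠ 0) (z : ℂ) :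
    Tendsto (fun N : ℕ ↦ ∏ m ∈ Icc (-(N : ℤ)) N, (1 - z ^ 2 / ((m : ℂ) + w) ^ 2)) atTop
      (𝓝 (sin (Real.pi * (w - z)) * sin (Real.pi * (w + z)) / sin (Real.pi * w) ^ 2)) := by
  simp_rw [prod_Icc_one_sub_sq_div_sq hw z]
  exact ((tendsto_euler_sin_prod _).mul (tendsto_euler_sin_prod _)).div
    ((tendsto_euler_sin_prod _).pow 2) (pow_ne_zero _ hw)

end SineProduct

open Filter Topology Complex

lemma Complex.sin_pi_mul_eq_exp (x : ℂ) :
    sin (Real.pi * x) = I / 2 * exp (-(I * Real.pi * x)) * (1 - exp (2 * Real.pi * I * x)) := by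
  have h : exp (2 * Real.pi * I * x) = exp (I * Real.pi * x) * exp (I * Real.pi * x) := by
    rw [← Complex.exp_add]; ring_nf
  have h' : exp (-(I * Real.pi * x)) * exp (I * Real.pi * x) = 1 := by
    rw [← Complex.exp_add]; simp
  rw [Complex.sin, h, show -(Real.pi * x) * I = -(I * Real.pi * x) by ring,
    show Real.pi * x * I = I * Real.pi * x by ring]
  linear_combination I / 2 * exp (I * Real.pi * x) * h'

lemma Complex.summable_one_div_int_add_sq (w : ℂ) :
    Summable fun m : ℤ ↦ 1 / ((m : ℂ) + w) ^ 2 := by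
  have := EisensteinSeries.linear_right_summable w 1 (k := 2) le_rfl
  refine this.congr fun m ↦ ?_
  simp [add_comm]

/-- Lipschitz's formula turns the sum into (2πi)² ∑ n qⁿ with q = exp(2πiw). -/
lemma Complex.norm_tsum_one_div_int_add_sq_le {w : ℂ} (hw : 0 < w.im) :
    ‖∑' m : ℤ, 1 / ((m : ℂ) + w) ^ 2‖ ≤
      4 * Real.pi ^ 2 * (‖exp (2 * Real.pi * I * w)‖ / (1 - ‖exp (2 * Real.pi * I * w)‖) ^ 2) := by
  have h := EisensteinSeries.qExpansion_identity le_rfl (k := 1) ⟨w, hw⟩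
  simp only [add_comm w, Nat.reduceAdd] at h
  rw [h]
  have hlt : ‖exp (2 * Real.pi * I * w)‖ < 1 := by
    rw [Complex.norm_exp, Real.exp_lt_one_iff]
    simp
    positivity
  have hs : HasSum (fun n : ℕ ↦ (n : ℂ) * exp (2 * Real.pi * I * w) ^ n) _ :=
    hasSum_coe_mul_geometric_of_norm_lt_one hlt
  have hs' := hasSum_coe_mul_geometric_of_norm_lt_one (r := ‖exp (2 * Real.pi * I * w)‖)
    (by simpa using hlt)
  rw [norm_mul]
  have h1 : ‖(-2 * (Real.pi : ℂ) * I) ^ (1 + 1) / (Nat.factorial 1 : ℂ)‖ = 4 * Real.pi ^ 2 := by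
    simp [abs_of_pos Real.pi_pos]
    ring
  simp only [pow_one]
  rw [h1]
  gcongr
  exact tsum_of_norm_bounded hs' fun n ↦ by simp

/-- Pairing the points m + nτ and -(m + nτ) cancels the linear exponents and leaves (1 - x²)
exp(x²), whose product is a sine quotient times a Gaussian factor. -/
lemma hasProd_neg_row_mul {τ z : ℂ} {n : ℤ} (hw : sin (Real.pi * (n * τ)) ≠ 0) {r r' : ℂ}
    (hr : HasProd (fun m : ℤ ↦ (1 - z / (m + n * τ)) *
      exp (z / (m + n * τ) + (z / (m + n * τ)) ^ 2 / 2)) r)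
    (hr' : HasProd (fun m : ℤ ↦ (1 - z / (m + ((-n : ℤ) : ℂ) * τ)) *
      exp (z / (m + ((-n : ℤ) : ℂ) * τ) + (z / (m + ((-n : ℤ) : ℂ) * τ)) ^ 2 / 2)) r') :
    r * r' = sin (Real.pi * (n * τ - z)) * sin (Real.pi * (n * τ + z)) /
      sin (Real.pi * (n * τ)) ^ 2 * exp (z ^ 2 * ∑' m : ℤ, 1 / ((m : ℂ) + n * τ) ^ 2) := by
  have hprod := hr.mul ((Equiv.neg ℤ).hasProd_iff.mpr hr')
  have hlim := hprod.comp (Finset.tendsto_Icc_neg (R := ℤ))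
  have hsum := ((summable_one_div_int_add_sq (n * τ)).hasSum.mul_left (z ^ 2)).cexp.comp
    (Finset.tendsto_Icc_neg (R := ℤ))
  have hlim' := (tendsto_prod_Icc_one_sub_sq_div_sq hw z).mul hsum
  refine tendsto_nhds_unique hlim (hlim'.congr fun N ↦ ?_)
  simp only [Function.comp_apply, ← Finset.prod_mul_distrib]
  refine Finset.prod_congr rfl fun m _ ↦ ?_
  have hneg : z / (((Equiv.neg ℤ m : ℤ) : ℂ) + ((-n : ℤ) : ℂ) * τ) = -(z / (m + n * τ)) := by
    rw [← div_neg]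
    congr 1
    simp
    ring
  rw [hneg]
  have : z ^ 2 * (1 / ((m : ℂ) + n * τ) ^ 2) = (z / (m + n * τ)) ^ 2 := by
    rw [div_pow]; ring
  rw [this, ← div_pow]
  generalize z / (m + n * τ) = x
  rw [mul_mul_mul_comm, ← Complex.exp_add]
  ring_nf

lemma hasProd_zero_row {z r : ℂ}
    (hr : HasProd (fun m : ℤ ↦ (1 - z / m) * exp (z / m + (z / m) ^ 2 / 2)) r) :
    Real.pi * z * r = sin (Real.pi * z) * exp (z ^ 2 * (Real.pi ^ 2 / 6)) := by
  have h1 := hr.nat_mul_neg.tendsto_prod_nat.comp (tendsto_add_atTop_nat 1)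
  have hz2 : HasSum (fun n : ℕ ↦ z ^ 2 * (1 / ((n : ℂ) + 1) ^ 2)) (z ^ 2 * (Real.pi ^ 2 / 6)) := by
    have h := (hasSum_nat_add_iff' 1).mpr hasSum_zeta_two
    have h' := (Complex.hasSum_ofReal.mpr h).mul_left (z ^ 2)
    simpa using h'
  have h2 := (tendsto_euler_sin_prod z).mul hz2.cexp.tendsto_prod_nat
  have h3 := h1.const_mul (Real.pi * z)
  -- `nat_mul_neg` counts the index 0 twice; this is harmless because the factor there is 1.
  simp only [Int.cast_zero, div_zero] at h3
  norm_num at h3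
  refine tendsto_nhds_unique h3 (h2.congr fun N ↦ ?_)
  simp only [Function.comp_apply]
  rw [Finset.prod_range_succ', mul_assoc (Real.pi * z), ← Finset.prod_mul_distrib]
  simp only [Nat.cast_zero, div_zero]
  norm_num
  left
  refine Finset.prod_congr rfl fun m _ ↦ ?_
  have : z ^ 2 * ((m + 1 : ℂ) ^ 2)⁻¹ = (z / (m + 1)) ^ 2 := by
    rw [div_pow]; ring
  rw [this, ← div_pow, show (-1 + -(m : ℂ)) = -(m + 1) by ring, div_neg]
  generalize z / ((m : ℂ) + 1) = x
  rw [mul_mul_mul_comm, ← Complex.exp_add]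
  ring_nf

/-! ### Infinite q-products. -/

/-- The infinite product `∏_{n ≥ 0} (1 - qⁿ u)`. -/
noncomputable def qProduct (q u : ℂ) : ℂ := ∏' n : ℕ, (1 - q ^ n * u)

section qProduct

variable {q : ℂ} (hq : ‖q‖ < 1)
include hq

lemma summable_norm_neg_pow_mul (u : ℂ) : Summable fun n : ℕ ↦ ‖-(q ^ n * u)‖ := by
  simpa using (summable_geometric_of_lt_one (norm_nonneg q) hq).mul_right ‖u‖

lemma multipliable_one_sub_pow_mul (u : ℂ) : Multipliable fun n : ℕ ↦ 1 - q ^ n * u := by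
  simpa only [sub_eq_add_neg] using
    multipliable_one_add_of_summable (summable_norm_neg_pow_mul hq u)

lemma tendsto_prod_qProduct (u : ℂ) :
    Tendsto (fun N ↦ ∏ n ∈ Finset.range N, (1 - q ^ n * u)) atTop (𝓝 (qProduct q u)) :=
  (multipliable_one_sub_pow_mul hq u).hasProd.tendsto_prod_nat

lemma qProduct_eq_one_sub_mul (u : ℂ) : qProduct q u = (1 - u) * qProduct q (q * u) := by
  have h (n : ℕ) : 1 - q ^ (n + 1) * u = 1 - q ^ n * (q * u) := by ring
  rw [qProduct, tprod_eq_zero_mul', qProduct]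
  · simp [h]
  · simpa only [h] using multipliable_one_sub_pow_mul hq (q * u)

/-- Factorwise comparison with the convergent real product of 1 - |q|ⁿρ, none of whose factors
vanishes. -/
lemma exists_pos_le_norm_qProduct {ρ : ℝ} (hρ0 : 0 ≤ ρ) (hρ : ρ < 1) :
    ∃ m : ℝ, 0 < m ∧ ∀ u : ℂ, ‖u‖ ≤ ρ → m ≤ ‖qProduct q u‖ := by
  have hfac (n : ℕ) : 0 < 1 - ‖q‖ ^ n * ρ := by
    have := mul_le_mul_of_nonneg_right (pow_le_one₀ (n := n) (norm_nonneg q) hq.le) hρ0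
    linarith
  have hs : Summable fun n : ℕ ↦ ‖-(‖q‖ ^ n * ρ)‖ := by
    simpa using (summable_geometric_of_lt_one (norm_nonneg q) hq).mul_right |ρ|
  have hm : Multipliable fun n : ℕ ↦ 1 - ‖q‖ ^ n * ρ := by
    simpa only [sub_eq_add_neg] using multipliable_one_add_of_summable hs
  have hlim := hm.hasProd.tendsto_prod_nat
  have hne : ∏' n : ℕ, (1 - ‖q‖ ^ n * ρ) ≠ 0 := by
    have := tprod_one_add_ne_zero_of_summable
      (fun n ↦ by simpa only [← sub_eq_add_neg] using (hfac n).ne') hs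
    simpa only [← sub_eq_add_neg] using this
  refine ⟨_, (ge_of_tendsto' hlim fun N ↦
    Finset.prod_nonneg fun n _ ↦ (hfac n).le).lt_of_ne' hne, fun u hu ↦ ?_⟩
  refine le_of_tendsto_of_tendsto' hlim (tendsto_prod_qProduct hq u).norm fun N ↦ ?_
  rw [norm_prod]
  refine Finset.prod_le_prod (fun n _ ↦ (hfac n).le) fun n _ ↦ ?_
  have h1 := norm_sub_norm_le (1 : ℂ) (q ^ n * u)
  have h2 : ‖q‖ ^ n * ‖u‖ ≤ ‖q‖ ^ n * ρ := by gcongr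
  simp only [norm_one, norm_mul, norm_pow] at h1
  linarith

end qProduct

/-! ### The q-product formula for σ. -/

lemma Complex.norm_exp_two_pi_I_mul (w : ℂ) :
    ‖exp (2 * Real.pi * I * w)‖ = Real.exp (-(2 * Real.pi * w.im)) := by
  rw [Complex.norm_exp]
  simp

lemma Complex.norm_exp_two_pi_I_mul_lt_one {w : ℂ} (hw : 0 < w.im) :
    ‖exp (2 * Real.pi * I * w)‖ < 1 := by
  rw [norm_exp_two_pi_I_mul, Real.exp_lt_one_iff, neg_lt_zero]
  positivity

lemma sin_pi_mul_ne_zero_of_im_pos {w : ℂ} (hw : 0 < w.im) : sin (Real.pi * w) ≠ 0 := by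
  rw [sin_pi_mul_eq_exp]
  refine mul_ne_zero (mul_ne_zero (by simp) (exp_ne_zero _)) (sub_ne_zero.mpr fun h ↦ ?_)
  have := norm_exp_two_pi_I_mul_lt_one hw
  rw [← h] at this
  simp at this

lemma sin_mul_sin_div_sin_sq (w z : ℂ) :
    sin (Real.pi * (w - z)) * sin (Real.pi * (w + z)) / sin (Real.pi * w) ^ 2 =
      (1 - exp (2 * Real.pi * I * w) * exp (2 * Real.pi * I * z)) *
      (1 - exp (2 * Real.pi * I * w) * (exp (2 * Real.pi * I * z))⁻¹) /
      (1 - exp (2 * Real.pi * I * w)) ^ 2 := by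
  rw [sin_pi_mul_eq_exp, sin_pi_mul_eq_exp, sin_pi_mul_eq_exp, ← Complex.exp_neg,
    ← Complex.exp_add, ← Complex.exp_add]
  have h1 : exp (-(I * Real.pi * (w - z))) * exp (-(I * Real.pi * (w + z))) =
      exp (-(I * Real.pi * w)) ^ 2 := by
    rw [← Complex.exp_add, ← Complex.exp_nat_mul]
    congr 1
    push_cast
    ring
  rw [show 2 * Real.pi * I * w + -(2 * Real.pi * I * z) = 2 * Real.pi * I * (w - z) by ring,
    ← mul_add]
  have h2 : I / 2 * exp (-(I * Real.pi * (w - z))) * (1 - exp (2 * Real.pi * I * (w - z))) *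
      (I / 2 * exp (-(I * Real.pi * (w + z))) * (1 - exp (2 * Real.pi * I * (w + z)))) =
      (I / 2 * exp (-(I * Real.pi * w))) ^ 2 * ((1 - exp (2 * Real.pi * I * (w + z))) *
        (1 - exp (2 * Real.pi * I * (w - z)))) := by
    rw [mul_pow, ← h1]
    ring
  rw [h2, mul_pow _ (1 - _), mul_div_mul_left]
  exact pow_ne_zero _ (mul_ne_zero (by simp) (exp_ne_zero _))

/-- The sum `∑_{n ≥ 1} ∑_m (m + n τ)⁻²`. -/
noncomputable def rowSum (τ : ℂ) : ℂ :=
  ∑' n : ℕ, ∑' m : ℤ, 1 / ((m : ℂ) + ((n + 1 : ℕ) : ℤ) * τ) ^ 2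

lemma norm_inner_rowSum_le {τ : ℂ} (hτ : 0 < τ.im) (n : ℕ) :
    ‖∑' m : ℤ, 1 / ((m : ℂ) + ((n + 1 : ℕ) : ℤ) * τ) ^ 2‖ ≤
      4 * Real.pi ^ 2 * (‖exp (2 * Real.pi * I * τ)‖ ^ n *
        (‖exp (2 * Real.pi * I * τ)‖ / (1 - ‖exp (2 * Real.pi * I * τ)‖) ^ 2)) := by
  have him : 0 < ((((n + 1 : ℕ) : ℤ) : ℂ) * τ).im := by
    simp
    positivity
  refine (norm_tsum_one_div_int_add_sq_le him).trans ?_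
  have hexp : exp (2 * Real.pi * I * ((((n + 1 : ℕ) : ℤ) : ℂ) * τ)) =
      exp (2 * Real.pi * I * τ) ^ (n + 1) := by
    rw [← Complex.exp_nat_mul]
    congr 1
    push_cast
    ring
  have hlt := norm_exp_two_pi_I_mul_lt_one hτ
  rw [hexp, norm_pow]
  have hpow : ‖exp (2 * Real.pi * I * τ)‖ ^ (n + 1) ≤ ‖exp (2 * Real.pi * I * τ)‖ :=
    pow_le_of_le_one (norm_nonneg _) hlt.le n.succ_ne_zero
  rw [← mul_div_assoc (‖exp (2 * Real.pi * I * τ)‖ ^ n), ← pow_succ]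
  have : 0 < 1 - ‖exp (2 * Real.pi * I * τ)‖ := by linarith
  gcongr

lemma summable_inner_rowSum {τ : ℂ} (hτ : 0 < τ.im) :
    Summable fun n : ℕ ↦ ∑' m : ℤ, 1 / ((m : ℂ) + ((n + 1 : ℕ) : ℤ) * τ) ^ 2 :=
  .of_norm_bounded (((summable_geometric_of_lt_one (norm_nonneg _)
    (norm_exp_two_pi_I_mul_lt_one hτ)).mul_right _).mul_left _) (norm_inner_rowSum_le hτ)

lemma norm_rowSum_le {τ : ℂ} (hτ : 0 < τ.im) :
    ‖rowSum τ‖ ≤ 4 * Real.pi ^ 2 *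
      (‖exp (2 * Real.pi * I * τ)‖ / (1 - ‖exp (2 * Real.pi * I * τ)‖) ^ 3) := by
  have hlt := norm_exp_two_pi_I_mul_lt_one hτ
  have h := tsum_of_norm_bounded (((hasSum_geometric_of_lt_one (norm_nonneg _) hlt).mul_right
    _).mul_left _) (norm_inner_rowSum_le hτ)
  refine h.trans (le_of_eq ?_)
  have : 1 - ‖exp (2 * Real.pi * I * τ)‖ ≠ 0 := by linarith
  field_simp

/-- Eisenstein summation: row 0 gives the sine, and the rows ±n give the n-th factors of the
q-products together with the n-th term of `rowSum`. -/
lemma pi_mul_mul_hasProd_eq {τ z a : ℂ} (hτ : 0 < τ.im) (hz : sin (Real.pi * z) ≠ 0)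
    (hs : Summable fun p : ℤ × ℤ ↦
      (1 - z / (p.2 + p.1 * τ)) * exp (z / (p.2 + p.1 * τ) + (z / (p.2 + p.1 * τ)) ^ 2 / 2) - 1)
    (hp : HasProd (fun p : ℤ × ℤ ↦
      (1 - z / (p.2 + p.1 * τ)) * exp (z / (p.2 + p.1 * τ) + (z / (p.2 + p.1 * τ)) ^ 2 / 2)) a) :
    Real.pi * z * a = sin (Real.pi * z) * exp (z ^ 2 * (Real.pi ^ 2 / 6 + rowSum τ)) *
      (qProduct (exp (2 * Real.pi * I * τ))
        (exp (2 * Real.pi * I * τ) * exp (2 * Real.pi * I * z)) *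
      qProduct (exp (2 * Real.pi * I * τ))
        (exp (2 * Real.pi * I * τ) * (exp (2 * Real.pi * I * z))⁻¹) /
      qProduct (exp (2 * Real.pi * I * τ)) (exp (2 * Real.pi * I * τ)) ^ 2) := by
  set q := exp (2 * Real.pi * I * τ) with hq
  set u := exp (2 * Real.pi * I * z) with hu
  have hq1 : ‖q‖ < 1 := norm_exp_two_pi_I_mul_lt_one hτ
  have hrow (n : ℤ) : Multipliable fun m : ℤ ↦ (1 - z / (m + n * τ)) *
      exp (z / (m + n * τ) + (z / (m + n * τ)) ^ 2 / 2) := by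
    have := multipliable_one_add_of_summable (hs.prod_factor n).norm
    simpa only [add_sub_cancel] using this
  choose r hr using fun n ↦ (hrow n)
  have hrows := (hp.prod_fiberwise hr).nat_mul_neg.tendsto_prod_nat.comp (tendsto_add_atTop_nat 1)
  have h0 : Real.pi * z * r 0 = sin (Real.pi * z) * exp (z ^ 2 * (Real.pi ^ 2 / 6)) :=
    hasProd_zero_row (by simpa using hr 0)
  -- Pairing rows n and -n counts row 0 twice, so `r 0` must be cancelled later.
  have hr0 : r 0 ≠ 0 := by
    intro h
    rw [h, mul_zero] at h0
    exact mul_ne_zero hz (exp_ne_zero _) h0.symm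
  have hqq : qProduct q q ≠ 0 := by
    obtain ⟨m, hm, h⟩ := exists_pos_le_norm_qProduct hq1 (norm_nonneg q) hq1
    exact norm_pos_iff.mp (hm.trans_le (h q le_rfl))
  have hpair (n : ℕ) : r ((n + 1 : ℕ) : ℤ) * r (-((n + 1 : ℕ) : ℤ)) =
      (1 - q ^ n * (q * u)) * (1 - q ^ n * (q * u⁻¹)) / (1 - q ^ n * q) ^ 2 *
        exp (z ^ 2 * ∑' m : ℤ, 1 / ((m : ℂ) + ((n + 1 : ℕ) : ℤ) * τ) ^ 2) := by
    have him : 0 < ((((n + 1 : ℕ) : ℤ) : ℂ) * τ).im := by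
      simp
      positivity
    have hexp : exp (2 * Real.pi * I * ((((n + 1 : ℕ) : ℤ) : ℂ) * τ)) = q ^ n * q := by
      rw [← pow_succ, hq, ← Complex.exp_nat_mul]
      congr 1
      push_cast
      ring
    rw [hasProd_neg_row_mul (sin_pi_mul_ne_zero_of_im_pos him) (hr _) (hr _),
      sin_mul_sin_div_sin_sq, hexp, ← hu, mul_assoc (q ^ n), mul_assoc (q ^ n)]
  have hlim := ((((tendsto_prod_qProduct hq1 (q * u)).mul
    (tendsto_prod_qProduct hq1 (q * u⁻¹))).div ((tendsto_prod_qProduct hq1 q).pow 2)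
    (pow_ne_zero 2 hqq)).mul
    ((summable_inner_rowSum hτ).hasSum.mul_left (z ^ 2)).cexp.tendsto_prod_nat).mul_const
    (r 0 * r 0)
  have heq := tendsto_nhds_unique hrows (hlim.congr fun N ↦ by
    simp only [Function.comp_apply, Pi.div_apply]
    rw [Finset.prod_range_succ', ← Finset.prod_mul_distrib, ← Finset.prod_pow,
      ← Finset.prod_div_distrib, ← Finset.prod_mul_distrib]
    simp only [hpair]
    simp)
  have ha : a = qProduct q (q * u) * qProduct q (q * u⁻¹) / qProduct q q ^ 2 *
      exp (z ^ 2 * rowSum τ) * r 0 := by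
    apply mul_right_cancel₀ hr0
    rw [heq, rowSum]
    ring
  rw [ha, mul_add, Complex.exp_add]
  linear_combination (qProduct q (q * u) * qProduct q (q * u⁻¹) / qProduct q q ^ 2 *
      exp (z ^ 2 * rowSum τ)) * h0

/-! ### The doubly periodic theta factor and its lower bound. -/

/-- The absolute value of `sin (π z) ∏_{n ≥ 1} (1 - qⁿ u) (1 - qⁿ / u)` for `q = exp (2 π i τ)` and
`u = exp (2 π i z)`, normalised so as to be doubly periodic. -/
noncomputable def normalizedTheta (τ z : ℂ) : ℝ :=
  ‖sin (Real.pi * z)‖ * ‖qProduct (exp (2 * Real.pi * I * τ))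
      (exp (2 * Real.pi * I * τ) * exp (2 * Real.pi * I * z)) *
    qProduct (exp (2 * Real.pi * I * τ))
      (exp (2 * Real.pi * I * τ) * (exp (2 * Real.pi * I * z))⁻¹)‖ *
    Real.exp (-(Real.pi * z.im ^ 2 / τ.im))

/-- The sine supplies the n = 0 factor of the first q-product, a form suited to the shift by τ. -/
lemma normalizedTheta_eq {τ : ℂ} (hτ : 0 < τ.im) (z : ℂ) : normalizedTheta τ z =
    2⁻¹ * ‖qProduct (exp (2 * Real.pi * I * τ)) (exp (2 * Real.pi * I * z)) *
      qProduct (exp (2 * Real.pi * I * τ))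
        (exp (2 * Real.pi * I * τ) * (exp (2 * Real.pi * I * z))⁻¹)‖ *
      Real.exp (Real.pi * z.im - Real.pi * z.im ^ 2 / τ.im) := by
  have h : ‖exp (-(I * Real.pi * z))‖ = Real.exp (Real.pi * z.im) := by
    rw [Complex.norm_exp]
    simp
  rw [qProduct_eq_one_sub_mul (norm_exp_two_pi_I_mul_lt_one hτ) (exp (2 * Real.pi * I * z)),
    normalizedTheta, sin_pi_mul_eq_exp, sub_eq_add_neg (Real.pi * z.im), Real.exp_add]
  simp only [norm_mul, h, norm_div, norm_I, norm_ofNat]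
  ring

lemma periodic_normalizedTheta_one (τ : ℂ) : Function.Periodic (normalizedTheta τ) 1 := by
  intro z
  have h : exp (2 * Real.pi * I * (z + 1)) = exp (2 * Real.pi * I * z) := by
    rw [mul_add, mul_one, Complex.exp_periodic]
  have h' : ‖sin (Real.pi * (z + 1))‖ = ‖sin (Real.pi * z)‖ := by
    rw [mul_add, mul_one, Complex.sin_add_pi, norm_neg]
  simp [normalizedTheta, h, h']

/-- The shift divides the modulus of the q-products by |u|, and the Gaussian factor compensates
exactly. -/
lemma periodic_normalizedTheta {τ : ℂ} (hτ : 0 < τ.im) :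
    Function.Periodic (normalizedTheta τ) τ := by
  intro z
  have hq1 := norm_exp_two_pi_I_mul_lt_one hτ
  have h : exp (2 * Real.pi * I * (z + τ)) =
      exp (2 * Real.pi * I * τ) * exp (2 * Real.pi * I * z) := by
    rw [← Complex.exp_add]
    ring_nf
  have hu := norm_exp_two_pi_I_mul z
  rw [normalizedTheta_eq hτ, normalizedTheta_eq hτ, h]
  have hu0 := exp_ne_zero (2 * Real.pi * I * z)
  have hq0 := exp_ne_zero (2 * Real.pi * I * τ)
  set q := exp (2 * Real.pi * I * τ)
  set u := exp (2 * Real.pi * I * z)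
  have h1 : q * (q * u)⁻¹ = u⁻¹ := by field_simp
  have h2 : ‖qProduct q (q * u) * qProduct q u⁻¹‖ * ‖u‖ =
      ‖qProduct q u * qProduct q (q * u⁻¹)‖ := by
    rw [← norm_mul, ← norm_neg, qProduct_eq_one_sub_mul hq1 u⁻¹, qProduct_eq_one_sub_mul hq1 u]
    congr 1
    field_simp
    ring
  have h3 : Real.exp (Real.pi * (z + τ).im - Real.pi * (z + τ).im ^ 2 / τ.im) =
      ‖u‖ * Real.exp (Real.pi * z.im - Real.pi * z.im ^ 2 / τ.im) := by
    rw [hu, ← Real.exp_add, add_im]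
    congr 1
    field_simp
    ring
  rw [h1, h3, ← h2]
  ring

lemma normalizedTheta_sub_lattice {τ : ℂ} (hτ : 0 < τ.im) (z : ℂ) (m n : ℤ) :
    normalizedTheta τ (z - (m + n * τ)) = normalizedTheta τ z := by
  have h1 := (periodic_normalizedTheta hτ).sub_zsmul_eq n (x := z)
  have h2 := (periodic_normalizedTheta_one τ).sub_zsmul_eq m (x := z - n • τ)
  rw [← h1, ← h2]
  congr 1
  simp
  ring

/-- From |sin π(x + iy)|² = sin²(πx) + sinh²(πy), with Jordan's inequality and sinh t ≥ t. -/
lemma two_mul_norm_le_norm_sin_pi_mul {z : ℂ} (hz : |z.re| ≤ 1 / 2) :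
    2 * ‖z‖ ≤ ‖sin (Real.pi * z)‖ := by
  have hπ := Real.pi_pos
  have hre : ((Real.pi : ℂ) * z).re = Real.pi * z.re := by simp
  have him : ((Real.pi : ℂ) * z).im = Real.pi * z.im := by simp
  have hsq : ‖sin (Real.pi * z)‖ ^ 2 =
      Real.sin (Real.pi * z.re) ^ 2 + Real.sinh (Real.pi * z.im) ^ 2 := by
    rw [Complex.sin_eq, hre, him, ← ofReal_sin, ← ofReal_cos, ← ofReal_sinh, ← ofReal_cosh,
      ← ofReal_mul, ← ofReal_mul, Complex.sq_norm, normSq_add_mul_I, mul_pow, mul_pow,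
      Real.cosh_sq, Real.cos_sq']
    ring
  have hsin : 2 * |z.re| ≤ |Real.sin (Real.pi * z.re)| := by
    have := Real.mul_abs_le_abs_sin (x := Real.pi * z.re) (by
      rw [abs_mul, abs_of_pos hπ]
      nlinarith)
    rw [abs_mul, abs_of_pos hπ] at this
    field_simp at this
    linarith
  have hsinh : 2 * |z.im| ≤ |Real.sinh (Real.pi * z.im)| := by
    rw [Real.abs_sinh, abs_mul, abs_of_pos hπ]
    have h1 := Real.self_le_sinh_iff.mpr (show 0 ≤ Real.pi * |z.im| by positivity)
    nlinarith [Real.two_le_pi, abs_nonneg z.im]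
  refine le_of_sq_le_sq ?_ (norm_nonneg _)
  rw [hsq, mul_pow, Complex.sq_norm, normSq_apply, ← sq_abs (Real.sin _), ← sq_abs (Real.sinh _)]
  have h1 := pow_le_pow_left₀ (by positivity) hsin 2
  have h2 := pow_le_pow_left₀ (by positivity) hsinh 2
  rw [mul_pow, sq_abs] at h1 h2
  linarith

/-- On this rectangle |qu| and |q/u| are at most exp(-π Im τ) < 1, so only the sine can vanish. -/
lemma exists_pos_mul_norm_le_normalizedTheta {τ : ℂ} (hτ : 0 < τ.im) : ∃ c : ℝ, 0 < c ∧
    ∀ z : ℂ, |z.re| ≤ 1 / 2 → |z.im| ≤ τ.im / 2 → c * ‖z‖ ≤ normalizedTheta τ z := by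
  have hq1 := norm_exp_two_pi_I_mul_lt_one hτ
  have hρ : Real.exp (-(Real.pi * τ.im)) < 1 := by
    rw [Real.exp_lt_one_iff]
    have := Real.pi_pos
    nlinarith
  obtain ⟨b, hb, hle⟩ := exists_pos_le_norm_qProduct hq1 (Real.exp_pos _).le hρ
  refine ⟨2 * (b * b) * Real.exp (-(Real.pi * τ.im / 4)), by positivity, fun z hre him ↦ ?_⟩
  have hbound (y : ℝ) (hy : -y ≤ τ.im / 2) :
      Real.exp (-(2 * Real.pi * τ.im)) * Real.exp (-(2 * Real.pi * y)) ≤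
        Real.exp (-(Real.pi * τ.im)) := by
    rw [← Real.exp_add, Real.exp_le_exp]
    nlinarith [Real.pi_pos]
  obtain ⟨him1, him2⟩ := abs_le.mp him
  have h1 := hle (exp (2 * Real.pi * I * τ) * exp (2 * Real.pi * I * z)) (by
    rw [norm_mul, norm_exp_two_pi_I_mul, norm_exp_two_pi_I_mul]
    exact hbound _ (by linarith))
  have h2 := hle (exp (2 * Real.pi * I * τ) * (exp (2 * Real.pi * I * z))⁻¹) (by
    rw [← Complex.exp_neg, ← mul_neg, norm_mul, norm_exp_two_pi_I_mul, norm_exp_two_pi_I_mul]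
    exact hbound _ (by simpa using him2))
  have h3 := two_mul_norm_le_norm_sin_pi_mul hre
  have h4 : Real.exp (-(Real.pi * τ.im / 4)) ≤ Real.exp (-(Real.pi * z.im ^ 2 / τ.im)) := by
    rw [Real.exp_le_exp, neg_le_neg_iff, div_le_iff₀ hτ]
    nlinarith [Real.pi_pos, mul_nonneg (sub_nonneg.mpr him2) (by linarith : 0 ≤ τ.im / 2 + z.im)]
  rw [normalizedTheta, norm_mul (qProduct _ _)]
  calc 2 * (b * b) * Real.exp (-(Real.pi * τ.im / 4)) * ‖z‖
      = (2 * ‖z‖) * (b * b) * Real.exp (-(Real.pi * τ.im / 4)) := by ring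
    _ ≤ _ := by gcongr

lemma exists_lattice_reduction {τ : ℂ} (hτ : 0 < τ.im) : ∃ C : ℝ, 0 < C ∧ ∀ z : ℂ, ∃ m n : ℤ,
    |(z - (m + n * τ)).re| ≤ 1 / 2 ∧ |(z - (m + n * τ)).im| ≤ τ.im / 2 ∧
    |(m : ℝ)| ≤ C * (1 + ‖z‖) ∧ |(n : ℝ)| ≤ C * (1 + ‖z‖) := by
  set K := 1 + τ.im⁻¹ with hK
  have hK1 : 1 ≤ K := by
    rw [hK]
    have : 0 < τ.im⁻¹ := by positivity
    linarith
  refine ⟨1 + K * (1 + ‖τ‖), by positivity, fun z ↦ ?_⟩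
  set n := round (z.im / τ.im) with hn
  set m := round (z.re - n * τ.re) with hm
  have hn1 := abs_sub_round (z.im / τ.im)
  have hm1 := abs_sub_round (z.re - n * τ.re)
  rw [← hn] at hn1
  rw [← hm] at hm1
  have hnK : |(n : ℝ)| ≤ K * (1 + ‖z‖) := by
    have h1 : |(n : ℝ)| ≤ |z.im / τ.im| + 1 / 2 := by
      have := abs_sub_abs_le_abs_sub (n : ℝ) (z.im / τ.im)
      rw [abs_sub_comm] at this
      linarith
    have h2 : |z.im / τ.im| ≤ τ.im⁻¹ * ‖z‖ := by
      rw [abs_div, abs_of_pos hτ, div_eq_inv_mul]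
      gcongr
      exact abs_im_le_norm z
    have h3 : 0 < τ.im⁻¹ := by positivity
    nlinarith [norm_nonneg z]
  refine ⟨m, n, ?_, ?_, ?_, ?_⟩
  · have : (z - (m + n * τ)).re = z.re - n * τ.re - m := by
      simp
      ring
    rwa [this]
  · have : (z - (m + n * τ)).im = (z.im / τ.im - n) * τ.im := by
      simp
      field_simp
    rw [this, abs_mul, abs_of_pos hτ]
    nlinarith
  · have h1 : |(m : ℝ)| ≤ |z.re - n * τ.re| + 1 / 2 := by
      have := abs_sub_abs_le_abs_sub (m : ℝ) (z.re - n * τ.re)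
      rw [abs_sub_comm (m : ℝ)] at this
      linarith
    have h2 : |z.re - n * τ.re| ≤ ‖z‖ + K * (1 + ‖z‖) * ‖τ‖ := by
      refine (abs_sub _ _).trans ?_
      rw [abs_mul]
      gcongr
      · exact abs_re_le_norm z
      · exact abs_re_le_norm τ
    have : 0 ≤ K * (1 + ‖z‖) := by positivity
    nlinarith [norm_nonneg z]
  · nlinarith [norm_nonneg z, norm_nonneg τ, mul_nonneg (mul_nonneg (zero_le_one.trans hK1)
      (norm_nonneg τ)) (add_nonneg zero_le_one (norm_nonneg z))]

/-! ### Positive definiteness of the quadratic form. -/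

lemma div_one_sub_pow_three_le {r b : ℝ} (hr0 : 0 ≤ r) (hr : r ≤ b) (hb : b < 1) :
    r / (1 - r) ^ 3 ≤ b / (1 - b) ^ 3 := by
  have : 0 < 1 - b := by linarith
  have := hr0.trans hr
  gcongr

/-- The factor 24 is 4π² divided by π²/6. The two inequalities make the coefficients of x² and y² in
the form positive. -/
lemma rowSum_bound_lt {τ : ℂ} (hτ : Real.sqrt 3 / 2 ≤ τ.im) (hτ' : τ.im ≤ 1.9) :
    24 * (‖exp (2 * Real.pi * I * τ)‖ / (1 - ‖exp (2 * Real.pi * I * τ)‖) ^ 3) < 1 ∧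
    Real.pi * τ.im * (1 +
      24 * (‖exp (2 * Real.pi * I * τ)‖ / (1 - ‖exp (2 * Real.pi * I * τ)‖) ^ 3)) < 6 := by
  rw [norm_exp_two_pi_I_mul]
  have hpos : 0 < τ.im := lt_of_lt_of_le (by positivity) hτ
  have h3 : (1.7 : ℝ) < Real.sqrt 3 := Real.lt_sqrt_of_sq_lt (by norm_num)
  have hπ1 := Real.pi_gt_d4
  have hπ2 := Real.pi_lt_d4
  have he := Real.exp_one_gt_d9
  have key (k : ℕ) (b : ℝ) (hb0 : 0 < b) (hk : 1 ≤ b * 2.718 ^ k)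
      (h : (k : ℝ) ≤ 2 * Real.pi * τ.im) :
      Real.exp (-(2 * Real.pi * τ.im)) ≤ b := by
    have h1 : Real.exp (-(2 * Real.pi * τ.im)) ≤ Real.exp (-(k : ℝ)) := by
      rw [Real.exp_le_exp]
      linarith
    have h2 : (2.718 : ℝ) ^ k ≤ Real.exp k := by
      rw [← Real.exp_one_pow]
      gcongr
      linarith
    refine h1.trans ?_
    rw [Real.exp_neg]
    refine inv_le_of_inv_le₀ hb0 (le_trans ?_ h2)
    rwa [inv_le_iff_one_le_mul₀' hb0]
  -- Near 1.9 the second inequality has little slack, so a sharper bound on |q| is needed there.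
  rcases le_total τ.im 1.5 with h | h
  · have hr := key 5 (1 / 140) (by norm_num) (by norm_num) (by push_cast; nlinarith)
    have hδ := div_one_sub_pow_three_le (Real.exp_pos _).le hr (by norm_num)
    norm_num at hδ
    constructor
    · linarith
    · have h4 : Real.pi * τ.im ≤ 3.1416 * 1.5 := by gcongr
      have h5 : 0 < Real.pi * τ.im := by nlinarith
      nlinarith
  · have hr := key 9 (1 / 8000) (by norm_num) (by norm_num) (by push_cast; nlinarith)
    have hδ := div_one_sub_pow_three_le (Real.exp_pos _).le hr (by norm_num)
    norm_num at hδ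
    constructor
    · linarith
    · have h4 : Real.pi * τ.im ≤ 3.1416 * 1.9 := by gcongr
      have h5 : 0 < Real.pi * τ.im := by nlinarith
      nlinarith

lemma exists_pos_mul_sq_le_re {τ : ℂ} (hτ : Real.sqrt 3 / 2 ≤ τ.im) (hτ' : τ.im ≤ 1.9) :
    ∃ κ : ℝ, 0 < κ ∧ ∀ z : ℂ, κ * ‖z‖ ^ 2 ≤
      (z ^ 2 * (Real.pi ^ 2 / 6 + rowSum τ)).re + Real.pi * z.im ^ 2 / τ.im := by
  have hpos : 0 < τ.im := lt_of_lt_of_le (by positivity) hτ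
  obtain ⟨h1, h2⟩ := rowSum_bound_lt hτ hτ'
  have hS := norm_rowSum_le hpos
  set ρ := ‖exp (2 * Real.pi * I * τ)‖ / (1 - ‖exp (2 * Real.pi * I * τ)‖) ^ 3
  have hπ := Real.pi_pos
  have ha : 0 < Real.pi ^ 2 / 6 * (1 - 24 * ρ) := by
    have : 0 < 1 - 24 * ρ := by linarith
    positivity
  have hb : 0 < Real.pi / τ.im - Real.pi ^ 2 / 6 * (1 + 24 * ρ) := by
    have : Real.pi / τ.im - Real.pi ^ 2 / 6 * (1 + 24 * ρ) =
        Real.pi / (6 * τ.im) * (6 - Real.pi * τ.im * (1 + 24 * ρ)) := by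
      field_simp
    rw [this]
    have : 0 < 6 - Real.pi * τ.im * (1 + 24 * ρ) := by linarith
    positivity
  refine ⟨min _ _, lt_min ha hb, fun z ↦ ?_⟩
  have hre : (z ^ 2 * (Real.pi ^ 2 / 6 + rowSum τ)).re =
      Real.pi ^ 2 / 6 * (z.re ^ 2 - z.im ^ 2) + (z ^ 2 * rowSum τ).re := by
    have : ((Real.pi : ℂ) ^ 2 / 6) = ((Real.pi ^ 2 / 6 : ℝ) : ℂ) := by push_cast; rfl
    rw [mul_add, add_re, this, re_mul_ofReal, sq z, mul_re]
    ring
  have hnorm : ‖z‖ ^ 2 = z.re ^ 2 + z.im ^ 2 := by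
    rw [Complex.sq_norm, normSq_apply]
    ring
  have hrow : -(‖z‖ ^ 2 * (4 * Real.pi ^ 2 * ρ)) ≤ (z ^ 2 * rowSum τ).re := by
    have h4 := neg_le_of_abs_le (abs_re_le_norm (z ^ 2 * rowSum τ))
    rw [norm_mul, norm_pow] at h4
    have h5 : ‖z‖ ^ 2 * ‖rowSum τ‖ ≤ ‖z‖ ^ 2 * (4 * Real.pi ^ 2 * ρ) := by gcongr
    linarith
  rw [hre]
  rw [hnorm] at hrow ⊢
  have hA := mul_le_mul_of_nonneg_right (min_le_left (Real.pi ^ 2 / 6 * (1 - 24 * ρ))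
    (Real.pi / τ.im - Real.pi ^ 2 / 6 * (1 + 24 * ρ))) (sq_nonneg z.re)
  have hB := mul_le_mul_of_nonneg_right (min_le_right (Real.pi ^ 2 / 6 * (1 - 24 * ρ))
    (Real.pi / τ.im - Real.pi ^ 2 / 6 * (1 + 24 * ρ))) (sq_nonneg z.im)
  have hdiv : Real.pi * z.im ^ 2 / τ.im = Real.pi / τ.im * z.im ^ 2 := by ring
  rw [hdiv]
  linarith

/-! ### Gaussian growth of σ. -/

namespace PeriodPair

variable (L : PeriodPair)

lemma ω₁_ne_zero : L.ω₁ ≠ 0 := by simpa using L.indep.ne_zero 0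

/-- Away from the lattice, `σ` grows like a Gaussian, up to the distance to the lattice. -/
lemma exists_le_norm_weierstrassSigma (hτ : Real.sqrt 3 / 2 ≤ (L.ω₂ / L.ω₁).im)
    (hτ' : (L.ω₂ / L.ω₁).im ≤ 1.9) :
    ∃ c κ C : ℝ, 0 < c ∧ 0 < κ ∧ 0 < C ∧ ∀ z ∉ L.lattice, ∃ m n : ℤ,
      |(m : ℝ)| ≤ C * (1 + ‖z‖) ∧ |(n : ℝ)| ≤ C * (1 + ‖z‖) ∧
      c * Real.exp (κ * ‖z‖ ^ 2) * ‖z - (m * L.ω₁ + n * L.ω₂)‖ ≤ ‖L.weierstrassSigma z‖ := by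
  have hω := L.ω₁_ne_zero
  have hω' : 0 < ‖L.ω₁‖ := norm_pos_iff.mpr hω
  have hpos : 0 < (L.ω₂ / L.ω₁).im := lt_of_lt_of_le (by positivity) hτ
  obtain ⟨κ, hκ, hQ⟩ := exists_pos_mul_sq_le_re hτ hτ'
  obtain ⟨c, hc, hF⟩ := exists_pos_mul_norm_le_normalizedTheta hpos
  obtain ⟨C, hC, hred⟩ := exists_lattice_reduction hpos
  have hq1 := norm_exp_two_pi_I_mul_lt_one hpos
  have hqq : 0 < ‖qProduct (exp (2 * Real.pi * I * (L.ω₂ / L.ω₁)))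
      (exp (2 * Real.pi * I * (L.ω₂ / L.ω₁)))‖ := by
    obtain ⟨m, hm, h⟩ := exists_pos_le_norm_qProduct hq1 (norm_nonneg _) hq1
    exact hm.trans_le (h _ le_rfl)
  set B := ‖qProduct (exp (2 * Real.pi * I * (L.ω₂ / L.ω₁)))
      (exp (2 * Real.pi * I * (L.ω₂ / L.ω₁)))‖ with hB
  refine ⟨c / (Real.pi * B ^ 2), κ / ‖L.ω₁‖ ^ 2, C * (1 + ‖L.ω₁‖⁻¹), by positivity, by positivity,
    by positivity, fun z hz ↦ ?_⟩
  obtain ⟨m, n, hre, him, hm, hn⟩ := hred (z / L.ω₁)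
  have hCle : C * (1 + ‖z / L.ω₁‖) ≤ C * (1 + ‖L.ω₁‖⁻¹) * (1 + ‖z‖) := by
    rw [mul_assoc, norm_div, div_eq_mul_inv]
    gcongr
    have := norm_nonneg z
    have : 0 < ‖L.ω₁‖⁻¹ := by positivity
    nlinarith
  refine ⟨m, n, hm.trans hCle, hn.trans hCle, ?_⟩
  obtain ⟨a, hσ, hs, hp⟩ := L.exists_hasProd_weierstrassSigma z
  have hsin : sin (Real.pi * (z / L.ω₁)) ≠ 0 := by
    intro h
    obtain ⟨k, hk⟩ := Complex.sin_eq_zero_iff.mp h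
    apply hz
    rw [mem_lattice]
    refine ⟨k, 0, ?_⟩
    have : (Real.pi : ℂ) ≠ 0 := by exact_mod_cast Real.pi_ne_zero
    rw [mul_comm (k : ℂ), mul_right_inj' this] at hk
    rw [← hk]
    field_simp
    simp
  have heq := pi_mul_mul_hasProd_eq hpos hsin hs hp
  have hFz : c * ‖z / L.ω₁ - (m + n * (L.ω₂ / L.ω₁))‖ ≤
      normalizedTheta (L.ω₂ / L.ω₁) (z / L.ω₁) := by
    rw [← normalizedTheta_sub_lattice hpos _ m n]
    exact hF _ hre him
  set w := z / L.ω₁ with hw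
  set τ := L.ω₂ / L.ω₁ with hτdef
  have hzw : z = L.ω₁ * w := by rw [hw]; field_simp
  have hdist : ‖z - (m * L.ω₁ + n * L.ω₂)‖ = ‖L.ω₁‖ * ‖w - (m + n * τ)‖ := by
    rw [← norm_mul]
    congr 1
    rw [hw, hτdef]
    field_simp
  have hwz : κ / ‖L.ω₁‖ ^ 2 * ‖z‖ ^ 2 = κ * ‖w‖ ^ 2 := by
    rw [hw, norm_div]
    field_simp
  clear_value w B
  -- The Gaussian built into `normalizedTheta` is returned here as the last term of the exponent.
  have hnorm : ‖L.weierstrassSigma z‖ = ‖L.ω₁‖ / (Real.pi * B ^ 2) * (normalizedTheta τ w *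
      Real.exp ((w ^ 2 * (Real.pi ^ 2 / 6 + rowSum τ)).re + Real.pi * w.im ^ 2 / τ.im)) := by
    have h1 := congrArg norm heq
    rw [norm_mul _ a, norm_mul, norm_mul _ (_ / _), norm_mul, norm_exp, norm_div, norm_pow,
      ← hB, Complex.norm_of_nonneg Real.pi_pos.le] at h1
    rw [hσ, norm_mul, hzw, norm_mul, normalizedTheta, Real.exp_add, Real.exp_neg]
    have h2 : ‖L.ω₁‖ * ‖w‖ * ‖a‖ = ‖L.ω₁‖ / Real.pi * (Real.pi * ‖w‖ * ‖a‖) := by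
      field_simp
    rw [h2, h1]
    field_simp
  rw [hnorm, hdist, hwz]
  calc c / (Real.pi * B ^ 2) * Real.exp (κ * ‖w‖ ^ 2) * (‖L.ω₁‖ * ‖w - (m + n * τ)‖)
      = ‖L.ω₁‖ / (Real.pi * B ^ 2) * ((c * ‖w - (m + n * τ)‖) * Real.exp (κ * ‖w‖ ^ 2)) := by
        ring
    _ ≤ _ := by
        gcongr
        · exact le_trans (by positivity) hFz
        · exact hQ w

end PeriodPair

lemma sqrt_three_div_two_le_im {τ : ℂ} (him : 0 < τ.im) (hnorm : 1 ≤ ‖τ‖)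
    (hre : τ.re ∈ Set.Icc (-(1 / 2) : ℝ) (1 / 2)) : Real.sqrt 3 / 2 ≤ τ.im := by
  have h1 : 1 ≤ ‖τ‖ ^ 2 := one_le_pow₀ hnorm
  rw [Complex.sq_norm, normSq_apply] at h1
  rw [div_le_iff₀ two_pos]
  refine Real.sqrt_le_iff.mpr ⟨by positivity, ?_⟩
  nlinarith [hre.1, hre.2]

/-! ### Heights and Liouville's inequality. -/

open NumberField IntermediateField

section Liouville

/-- Every archimedean absolute value of a number field is bounded by the multiplicative height. -/
lemma NumberField.infinitePlace_le_mulHeight₁ {K : Type*} [Field K] [NumberField K] (x : K)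
    (v : InfinitePlace K) : v x ≤ Height.mulHeight₁ x := by
  classical
  rw [NumberField.mulHeight₁_eq]
  have h1 (w : InfinitePlace K) : 1 ≤ max (w x) 1 ^ w.mult := one_le_pow₀ (le_max_right _ _)
  have h2 : v x ≤ ∏ w : InfinitePlace K, max (w x) 1 ^ w.mult := by
    calc v x ≤ max (v x) 1 := le_max_left _ _
      _ ≤ max (v x) 1 ^ v.mult := le_self_pow₀ (le_max_right _ _) v.mult_ne_zero
      _ ≤ _ := by
        rw [← Finset.mul_prod_erase _ _ (Finset.mem_univ v)]
        exact le_mul_of_one_le_right (zero_le_one.trans (h1 v))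
          (Finset.prod_induction _ (1 ≤ ·) (fun _ _ ↦ one_le_mul_of_one_le_of_one_le) le_rfl
            fun w _ ↦ h1 w)
  have h3 : 1 ≤ ∏ᶠ w : FinitePlace K, max (w x) 1 :=
    finprod_induction (1 ≤ ·) le_rfl (fun _ _ ↦ one_le_mul_of_one_le_of_one_le)
      fun w ↦ le_max_right _ _
  exact h2.trans (le_mul_of_one_le_right
    (Finset.prod_nonneg fun w _ ↦ zero_le_one.trans (h1 w)) h3)

/-- An algebraic number has a denominator, and all its conjugates are bounded, by `H(x) ^ deg x`. -/
lemma NumberField.exists_denominator_and_conj_le {x : ℂ} (hx : IsAlgebraic ℚ x) :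
    (∃ n : ℕ, n ≠ 0 ∧ (n : ℝ) ≤ absMulHeight₁ x ^ Module.finrank ℚ ℚ⟮x⟯ ∧
      IsIntegral ℤ ((n : ℂ) * x)) ∧
    ∀ (K : IntermediateField ℚ ℂ) (hK : x ∈ K) (φ : K →ₐ[ℚ] ℂ),
      ‖φ ⟨x, hK⟩‖ ≤ absMulHeight₁ x ^ Module.finrank ℚ ℚ⟮x⟯ := by
  have hint : IsIntegral ℚ x := hx.isIntegral
  have : FiniteDimensional ℚ ℚ⟮x⟯ := adjoin.finiteDimensional hint
  have : NumberField ℚ⟮x⟯ := {}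
  have hpow : absMulHeight₁ x ^ Module.finrank ℚ ℚ⟮x⟯ =
      Height.mulHeight₁ (AdjoinSimple.gen ℚ x) := by
    rw [absMulHeight₁, dif_pos hint, Real.rpow_inv_natCast_pow (Height.mulHeight₁_nonneg _)
      Module.finrank_pos.ne']
  rw [hpow]
  constructor
  · obtain ⟨n, hn, hle, hi⟩ := NumberField.exists_nat_le_mulHeight₁ (AdjoinSimple.gen ℚ x)
    refine ⟨n, hn, hle, ?_⟩
    simpa using hi.map (algebraMap ℚ⟮x⟯ ℂ).toIntAlgHom
  · intro K hK φ
    have hle : ℚ⟮x⟯ ≤ K := by simpa using hK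
    have := infinitePlace_le_mulHeight₁ (AdjoinSimple.gen ℚ x)
      (InfinitePlace.mk (φ.comp (inclusion hle)).toRingHom)
    simpa [InfinitePlace.apply] using! this

/-- Liouville's inequality for a nonzero algebraic integer. -/
lemma one_le_norm_mul_pow_of_isIntegral {K : IntermediateField ℚ ℂ} [FiniteDimensional ℚ K] {β : K}
    (hβ : IsIntegral ℤ β) (hβ0 : β ≠ 0) {B : ℝ} (hB1 : 1 ≤ B)
    (hB : ∀ φ : K →ₐ[ℚ] ℂ, ‖φ β‖ ≤ B) : 1 ≤ ‖(β : ℂ)‖ * B ^ Module.finrank ℚ K := by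
  classical
  have hnorm := Algebra.norm_eq_prod_embeddings ℚ ℂ β
  have hint : IsIntegral ℤ (Algebra.norm ℚ β) := Algebra.isIntegral_norm ℚ hβ
  obtain ⟨k, hk⟩ := IsIntegrallyClosed.isIntegral_iff.mp hint
  have hk0 : k ≠ 0 := by
    rintro rfl
    rw [map_zero, eq_comm, Algebra.norm_eq_zero_iff] at hk
    exact hβ0 hk
  have h1 : 1 ≤ ‖∏ φ : K →ₐ[ℚ] ℂ, φ β‖ := by
    rw [← hnorm, ← hk]
    simpa using Int.one_le_abs hk0 |> (Int.cast_le (R := ℝ)).mpr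
  refine h1.trans ?_
  -- The identity embedding is kept apart; every other conjugate is bounded by B.
  rw [norm_prod, ← Finset.mul_prod_erase Finset.univ (fun φ : K →ₐ[ℚ] ℂ ↦ ‖φ β‖)
    (Finset.mem_univ K.val)]
  refine mul_le_mul_of_nonneg_left ?_ (norm_nonneg _)
  refine (Finset.prod_le_prod (fun _ _ ↦ norm_nonneg _) fun φ _ ↦ hB φ).trans ?_
  rw [Finset.prod_const]
  refine pow_le_pow_right₀ hB1 ?_
  rw [← AlgHom.card ℚ K ℂ, ← Finset.card_univ]
  exact Finset.card_le_card (Finset.erase_subset _ _)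

end Liouville

lemma NumberField.absMulHeight₁_nonneg (x : ℂ) : 0 ≤ absMulHeight₁ x := by
  unfold absMulHeight₁
  split_ifs with h
  · exact Real.rpow_nonneg (by
      have : FiniteDimensional ℚ ℚ⟮x⟯ := adjoin.finiteDimensional h
      have : NumberField ℚ⟮x⟯ := {}
      exact Height.mulHeight₁_nonneg _) _
  · exact zero_le_one

lemma NumberField.absMulHeight₁_pow_finrank_le {x : ℂ} {F : IntermediateField ℚ ℂ}
    [FiniteDimensional ℚ F] (hx : x ∈ F) {d H : ℝ} (hH : 1 ≤ H) (hxH : absMulHeight₁ x ≤ H)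
    (hF : (Module.finrank ℚ F : ℝ) ≤ d) :
    absMulHeight₁ x ^ Module.finrank ℚ ℚ⟮x⟯ ≤ H ^ d := by
  have hle : Module.finrank ℚ ℚ⟮x⟯ ≤ Module.finrank ℚ F := by
    have : ℚ⟮x⟯ ≤ F := by simpa using hx
    exact Submodule.finrank_mono (s := ℚ⟮x⟯.toSubmodule) (t := F.toSubmodule) this
  calc absMulHeight₁ x ^ Module.finrank ℚ ℚ⟮x⟯ ≤ H ^ Module.finrank ℚ ℚ⟮x⟯ :=
        pow_le_pow_left₀ (absMulHeight₁_nonneg x) hxH _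
    _ = H ^ (Module.finrank ℚ ℚ⟮x⟯ : ℝ) := (Real.rpow_natCast _ _).symm
    _ ≤ H ^ d := Real.rpow_le_rpow_of_exponent_le hH ((Nat.cast_le.mpr hle).trans hF)

/-- Liouville's inequality for the distance of an algebraic number to the points of a lattice with
algebraic periods. -/
lemma PeriodPair.exists_log_norm_sub_lattice_bound (L : PeriodPair)
    (hω₁ : IsAlgebraic ℚ L.ω₁) (hω₂ : IsAlgebraic ℚ L.ω₂) {C : ℝ} (hC : 0 < C) :
    ∃ D E : ℝ, 0 ≤ D ∧ 0 ≤ E ∧ ∀ (d H : ℝ) (z : ℂ) (F : IntermediateField ℚ ℂ) (m n : ℤ),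
      1 ≤ d → 1 ≤ H → z ∉ L.lattice → IsAlgebraic ℚ z → absMulHeight₁ z ≤ H →
      FiniteDimensional ℚ F → z ∈ F → (Module.finrank ℚ F : ℝ) ≤ d →
      |(m : ℝ)| ≤ C * (1 + ‖z‖) → |(n : ℝ)| ≤ C * (1 + ‖z‖) →
      0 ≤ Real.log ‖z - (m * L.ω₁ + n * L.ω₂)‖ +
        (d * D + 1) * (E + 2 * (d * Real.log H) + ‖z‖) := by
  obtain ⟨⟨N₁, hN₁, -, hi₁⟩, hc₁⟩ := exists_denominator_and_conj_le hω₁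
  obtain ⟨⟨N₂, hN₂, -, hi₂⟩, hc₂⟩ := exists_denominator_and_conj_le hω₂
  set W₁ := absMulHeight₁ L.ω₁ ^ Module.finrank ℚ ℚ⟮L.ω₁⟯
  set W₂ := absMulHeight₁ L.ω₂ ^ Module.finrank ℚ ℚ⟮L.ω₂⟯
  have hW₁ : 0 ≤ W₁ := pow_nonneg (absMulHeight₁_nonneg _) _
  have hW₂ : 0 ≤ W₂ := pow_nonneg (absMulHeight₁_nonneg _) _
  set G := ℚ⟮L.ω₁⟯ ⊔ ℚ⟮L.ω₂⟯ with hG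
  have : FiniteDimensional ℚ ℚ⟮L.ω₁⟯ := adjoin.finiteDimensional hω₁.isIntegral
  have : FiniteDimensional ℚ ℚ⟮L.ω₂⟯ := adjoin.finiteDimensional hω₂.isIntegral
  have : FiniteDimensional ℚ G := IntermediateField.finiteDimensional_sup _ _
  set N : ℝ := N₁ * N₂ with hN
  have hN1 : 1 ≤ N := by
    rw [hN]
    exact_mod_cast Nat.one_le_iff_ne_zero.mpr (mul_ne_zero hN₁ hN₂)
  refine ⟨Module.finrank ℚ G, Real.log N + Real.log (1 + C * (W₁ + W₂)), by positivity,
    add_nonneg (Real.log_nonneg hN1) (Real.log_nonneg (by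
      have : 0 ≤ C * (W₁ + W₂) := by positivity
      linarith)), ?_⟩
  intro d H z F m n hd hH hzL hz hzH _ hzF hF hm hn
  obtain ⟨⟨k, hk, hkle, hik⟩, hcz⟩ := exists_denominator_and_conj_le hz
  have hh := absMulHeight₁_pow_finrank_le hzF hH hzH hF
  set h := H ^ d with hhdef
  have hh1 : 1 ≤ h := Real.one_le_rpow hH (by linarith)
  have hlogh : Real.log h = d * Real.log H := Real.log_rpow (by linarith) d
  set K := F ⊔ G
  have hGK : G ≤ K := le_sup_right
  have hzK : z ∈ K := (le_sup_left : F ≤ K) hzF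
  have h₁K : L.ω₁ ∈ K := hGK ((le_sup_left : ℚ⟮L.ω₁⟯ ≤ G) (mem_adjoin_simple_self ℚ _))
  have h₂K : L.ω₂ ∈ K := hGK ((le_sup_right : ℚ⟮L.ω₂⟯ ≤ G) (mem_adjoin_simple_self ℚ _))
  have : FiniteDimensional ℚ K := IntermediateField.finiteDimensional_sup _ _
  have hKfin : (Module.finrank ℚ K : ℝ) ≤ d * Module.finrank ℚ G := by
    have : (Module.finrank ℚ K : ℝ) ≤ Module.finrank ℚ F * Module.finrank ℚ G := by
      exact_mod_cast IntermediateField.finrank_sup_le F G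
    exact this.trans (by gcongr)
  -- The three denominators make z - ω an algebraic integer.
  let β : K := (N₁ * N₂ * k : ℕ) * (⟨z, hzK⟩ - (m * ⟨L.ω₁, h₁K⟩ + n * ⟨L.ω₂, h₂K⟩))
  have hβcoe : (β : ℂ) = (N₁ * N₂ * k : ℕ) * (z - (m * L.ω₁ + n * L.ω₂)) := by
    simp [β]
  have hdist : z - (m * L.ω₁ + n * L.ω₂) ≠ 0 := fun h0 ↦
    hzL (mem_lattice.mpr ⟨m, n, (sub_eq_zero.mp h0).symm⟩)
  have hβ0 : β ≠ 0 := by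
    intro h0
    have : (β : ℂ) = 0 := by rw [h0]; rfl
    rw [hβcoe] at this
    exact mul_ne_zero (Nat.cast_ne_zero.mpr (mul_ne_zero (mul_ne_zero hN₁ hN₂) hk)) hdist this
  have hβint : IsIntegral ℤ β := by
    rw [← isIntegral_algebraMap_iff (algebraMap K ℂ).injective]
    change IsIntegral ℤ (β : ℂ)
    have hnat (j : ℕ) : IsIntegral ℤ (j : ℂ) :=
      map_natCast (algebraMap ℤ ℂ) j ▸ isIntegral_algebraMap
    have hcast (j : ℤ) : IsIntegral ℤ (j : ℂ) :=
      map_intCast (algebraMap ℤ ℂ) j ▸ isIntegral_algebraMap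
    have : (β : ℂ) = (N₁ : ℂ) * N₂ * (k * z) - (m * (N₂ * k) * (N₁ * L.ω₁) +
        n * (N₁ * k) * (N₂ * L.ω₂)) := by
      rw [hβcoe]
      push_cast
      ring
    rw [this]
    exact (((hnat _).mul (hnat _)).mul hik).sub
      ((((hcast _).mul ((hnat _).mul (hnat _))).mul hi₁).add
        (((hcast _).mul ((hnat _).mul (hnat _))).mul hi₂))
  have hkh : (k : ℝ) ≤ h := hkle.trans hh
  have hX : 0 ≤ ‖z‖ := norm_nonneg z
  have hφ (φ : K →ₐ[ℚ] ℂ) : ‖φ β‖ ≤ N * h * (h * (1 + C * (W₁ + W₂)) * (1 + ‖z‖)) := by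
    have hβ : φ β = (N₁ * N₂ * k : ℕ) *
        (φ ⟨z, hzK⟩ - (m * φ ⟨L.ω₁, h₁K⟩ + n * φ ⟨L.ω₂, h₂K⟩)) := by
      simp [β]
    have hm' : ‖(m : ℂ) * φ ⟨L.ω₁, h₁K⟩‖ ≤ C * (1 + ‖z‖) * W₁ := by
      rw [norm_mul, Complex.norm_intCast]
      exact mul_le_mul hm (hc₁ K h₁K φ) (norm_nonneg _) (by positivity)
    have hn' : ‖(n : ℂ) * φ ⟨L.ω₂, h₂K⟩‖ ≤ C * (1 + ‖z‖) * W₂ := by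
      rw [norm_mul, Complex.norm_intCast]
      exact mul_le_mul hn (hc₂ K h₂K φ) (norm_nonneg _) (by positivity)
    have hz' : ‖φ ⟨z, hzK⟩‖ ≤ h := (hcz K hzK φ).trans hh
    rw [hβ, norm_mul, Complex.norm_natCast]
    push_cast
    rw [← hN]
    have hsum : ‖φ ⟨z, hzK⟩ - (m * φ ⟨L.ω₁, h₁K⟩ + n * φ ⟨L.ω₂, h₂K⟩)‖ ≤
        h * (1 + C * (W₁ + W₂)) * (1 + ‖z‖) := by
      refine (norm_sub_le _ _).trans ((add_le_add hz' ((norm_add_le _ _).trans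
        (add_le_add hm' hn'))).trans ?_)
      have h1 : 0 ≤ C * (1 + ‖z‖) * (W₁ + W₂) := by positivity
      have h2 := mul_le_mul_of_nonneg_right hh1 h1
      nlinarith
    gcongr
  have hhM : 1 ≤ h * (1 + C * (W₁ + W₂)) * (1 + ‖z‖) := by
    have : 0 ≤ C * (W₁ + W₂) := by positivity
    exact one_le_mul_of_one_le_of_one_le (one_le_mul_of_one_le_of_one_le hh1 (by linarith))
      (by linarith)
  set B := N * h * (h * (1 + C * (W₁ + W₂)) * (1 + ‖z‖)) with hB
  have hNh : 1 ≤ N * h := one_le_mul_of_one_le_of_one_le hN1 hh1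
  have hB1 : 1 ≤ B := one_le_mul_of_one_le_of_one_le hNh hhM
  have hlio := one_le_norm_mul_pow_of_isIntegral hβint hβ0 hB1 hφ
  have hβle : ‖(β : ℂ)‖ ≤ B * ‖z - (m * L.ω₁ + n * L.ω₂)‖ := by
    rw [hβcoe, norm_mul, Complex.norm_natCast]
    push_cast
    rw [← hN]
    gcongr
    calc N * k ≤ N * h := by gcongr
      _ ≤ B := le_mul_of_one_le_right (by positivity) hhM
  have hpos : 0 < ‖z - (m * L.ω₁ + n * L.ω₂)‖ := norm_pos_iff.mpr hdist
  have hB0 : 0 < B := by linarith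
  -- Passing from β back to z - ω costs one more factor B, hence the `+ 1` in `d * D + 1`.
  have hfinal : 1 ≤ ‖z - (m * L.ω₁ + n * L.ω₂)‖ * B ^ (Module.finrank ℚ K + 1) := by
    calc 1 ≤ ‖(β : ℂ)‖ * B ^ Module.finrank ℚ K := hlio
      _ ≤ B * ‖z - (m * L.ω₁ + n * L.ω₂)‖ * B ^ Module.finrank ℚ K := by gcongr
      _ = _ := by ring
  have hlog := Real.log_nonneg hfinal
  rw [Real.log_mul hpos.ne' (by positivity), Real.log_pow] at hlog
  push_cast at hlog
  have hlogB : Real.log B ≤ Real.log N + Real.log (1 + C * (W₁ + W₂)) + 2 * (d * Real.log H) +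
      ‖z‖ := by
    have hN0 : N ≠ 0 := by linarith
    have hh0 : h ≠ 0 := by linarith
    have hM0 : 1 + C * (W₁ + W₂) ≠ 0 := by positivity
    have hX0 : 1 + ‖z‖ ≠ 0 := by positivity
    rw [hB, Real.log_mul (mul_ne_zero hN0 hh0) (mul_ne_zero (mul_ne_zero hh0 hM0) hX0),
      Real.log_mul hN0 hh0, Real.log_mul (mul_ne_zero hh0 hM0) hX0, Real.log_mul hh0 hM0, hlogh]
    -- The crude bound log(1 + |z|) ≤ |z| suffices, since a term d|z| is absorbed by κ|z|².
    have := Real.log_le_sub_one_of_pos (show 0 < 1 + ‖z‖ by positivity)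
    linarith
  have hlogB0 := Real.log_nonneg hB1
  refine hlog.trans (add_le_add le_rfl ?_)
  gcongr

/-! ### Conclusion: comparison of the two bounds. -/

/-- If X > s, then s² ≤ sX and one factor X can be cancelled. It is used with s = d√(log H). -/
lemma le_mul_of_mul_sq_le {κ P R s X : ℝ} (hκ : 0 < κ) (hP : 0 ≤ P) (hR : 0 ≤ R) (hs : 0 ≤ s)
    (h : κ * X ^ 2 ≤ P * s ^ 2 + R * (s * X)) : X ≤ ((P + R) / κ + 1) * s := by
  by_contra! hlt
  have hA : 0 ≤ (P + R) / κ := by positivity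
  have hsX : s < X := by nlinarith
  have hX : 0 < X := by linarith
  have h1 : κ * X ^ 2 ≤ (P + R) * s * X := by
    have : P * s ^ 2 ≤ P * (s * X) := by
      rw [sq]
      gcongr
    linarith
  have h2 : κ * X ≤ (P + R) * s := by
    refine le_of_mul_le_mul_right ?_ hX
    linarith
  have h3 : X ≤ (P + R) / κ * s := by
    rw [div_mul_eq_mul_div, le_div_iff₀ hκ]
    linarith
  linarith

theorem proposition3p4 (L : PeriodPair)
    (hτ_pos : 0 < (L.ω₂ / L.ω₁).im)
    (hτ_norm : 1 ≤ ‖L.ω₂ / L.ω₁‖)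
    (hτ_re : (L.ω₂ / L.ω₁).re ∈ Set.Icc (-(1 / 2) : ℝ) (1 / 2))
    (hτ_im : (L.ω₂ / L.ω₁).im ≤ 1.9)
    (hω₁ : IsAlgebraic ℚ L.ω₁) (hω₂ : IsAlgebraic ℚ L.ω₂) :
    ∃ A : ℝ, 0 < A ∧
      ∀ d H : ℝ, 1 ≤ d → Real.exp 1 ≤ H →
      ∀ z : ℂ, z ∉ L.lattice →
        IsAlgebraic ℚ z → IsAlgebraic ℚ (L.weierstrassSigma z) →
        max (NumberField.absMulHeight₁ z)
          (NumberField.absMulHeight₁ (L.weierstrassSigma z)) ≤ H →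
        (Module.finrank ℚ
          (IntermediateField.adjoin ℚ ({z, L.weierstrassSigma z} : Set ℂ)) : ℝ) ≤ d →
        ‖z‖ ≤ A * d * Real.sqrt (Real.log H) := by
  obtain ⟨c, κ, C, hc, hκ, hC, hσ⟩ := L.exists_le_norm_weierstrassSigma
    (sqrt_three_div_two_le_im hτ_pos hτ_norm hτ_re) hτ_im
  obtain ⟨D, E, hD, hE, hlio⟩ := L.exists_log_norm_sub_lattice_bound hω₁ hω₂ hC
  refine ⟨(1 + |Real.log c| + (D + 1) * (E + 2) + (D + 1)) / κ + 1, by positivity, ?_⟩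
  intro d H hd hH z hz hzalg hσalg hmax hfin
  have hH1 : 1 ≤ H := (Real.one_le_exp zero_le_one).trans hH
  have hℓ : 1 ≤ Real.log H := (Real.le_log_iff_exp_le (by linarith)).mpr hH
  obtain ⟨m, n, hm, hn, hle⟩ := hσ z hz
  set F := IntermediateField.adjoin ℚ ({z, L.weierstrassSigma z} : Set ℂ) with hF
  have hFfin : FiniteDimensional ℚ F := IntermediateField.finiteDimensional_adjoin
    fun x hx ↦ by
      rcases hx with rfl | rfl
      exacts [hzalg.isIntegral, hσalg.isIntegral]
  have hzF : z ∈ F := subset_adjoin ℚ _ (by simp)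
  have hσF : L.weierstrassSigma z ∈ F := subset_adjoin ℚ _ (by simp)
  have h1 := hlio d H z F m n hd hH1 hz hzalg ((le_max_left _ _).trans hmax) hFfin hzF hfin hm hn
  have h2 : ‖L.weierstrassSigma z‖ ≤ H ^ d :=
    ((exists_denominator_and_conj_le hσalg).2 F hσF F.val).trans
      (absMulHeight₁_pow_finrank_le hσF hH1 ((le_max_right _ _).trans hmax) hfin)
  have hdist : 0 < ‖z - (m * L.ω₁ + n * L.ω₂)‖ := norm_pos_iff.mpr fun h0 ↦
    hz (PeriodPair.mem_lattice.mpr ⟨m, n, (sub_eq_zero.mp h0).symm⟩)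
  have h3 := Real.log_le_log (by positivity) (hle.trans h2)
  rw [Real.log_mul (by positivity) hdist.ne', Real.log_mul hc.ne' (Real.exp_pos _).ne',
    Real.log_exp, Real.log_rpow (by linarith)] at h3
  have hX := norm_nonneg z
  rw [mul_assoc]
  set ℓ := Real.log H
  have hsq : (d * Real.sqrt ℓ) ^ 2 = d ^ 2 * ℓ := by
    rw [mul_pow, Real.sq_sqrt (by linarith)]
  -- H ≥ e gives log H ≥ 1, so the linear term d|z| fits the shape s|z|.
  have hds : d ≤ d * Real.sqrt ℓ := le_mul_of_one_le_right (by linarith) (Real.one_le_sqrt.mpr hℓ)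
  refine le_mul_of_mul_sq_le hκ (by positivity) (by positivity) (by positivity) ?_
  rw [hsq]
  have hdℓ : d * ℓ ≤ d ^ 2 * ℓ := by
    rw [sq, mul_assoc]
    exact le_mul_of_one_le_left (by positivity) hd
  have hd2ℓ : 1 ≤ d ^ 2 * ℓ := one_le_mul_of_one_le_of_one_le (one_le_pow₀ hd) hℓ
  have hdD : d * D + 1 ≤ d * (D + 1) := by linarith
  have hEd : E ≤ E * (d * ℓ) :=
    le_mul_of_one_le_right hE (one_le_mul_of_one_le_of_one_le hd hℓ)
  have h4 : (d * D + 1) * (E + 2 * (d * ℓ) + ‖z‖) ≤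
      (D + 1) * (E + 2) * (d ^ 2 * ℓ) + (D + 1) * (d * Real.sqrt ℓ * ‖z‖) := by
    calc (d * D + 1) * (E + 2 * (d * ℓ) + ‖z‖)
        ≤ d * (D + 1) * (E * (d * ℓ) + 2 * (d * ℓ) + ‖z‖) := by gcongr
      _ = (D + 1) * (E + 2) * (d ^ 2 * ℓ) + (D + 1) * (d * ‖z‖) := by ring
      _ ≤ _ := by gcongr
  have h5 := neg_abs_le (Real.log c)
  have h6 := mul_le_mul_of_nonneg_left hd2ℓ (abs_nonneg (Real.log c))
  linarith
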